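/- Let $m\ge 3$ and $n=\frac{3^m-1}{2}$. Let $\alpha$ be a generator of $\mathrm{GF}(3^m)^*$ and $\beta=\alpha^{(3^m-1)/n}$, a primitive $n$-th root of unity; let $m_i(x)$ be the minimal polynomial of $\beta^i$ over $\mathrm{GF}(3)$. The $3$-cyclotomic coset of $s$ modulo $n$ is $C_s=\{s3^j \bmod n : j\ge 0\}\subseteq\{0,\dots,n-1\}$, its smallest element is its coset leader, and $\delta_1$ denotes the largest of all coset leaders modulo $n$. Let $\tilde{\mathcal C}_{(n,3,m,\delta_1)}$ be the ternary cyclic code of length $n$, i.e. the ideal of $\mathrm{GF}(3)[x]/(x^n-1)$ (with polynomials identified with their coefficient vectors $(c_0,\dots,c_{n-1})$), generated by $$\tilde g(x)=(x-1)\,\mathrm{lcm}\big(m_1(x),m_2(x),\dots,m_{\delta_1-1}(x)\big).$$ Then $\tilde{\mathcal C}_{(n,3,m,\delta_1)}$ is a linear code with parameters $\left[\frac{3^m-1}{2},k,d\right]$ (length, dimension, minimum Hamming distance), where $$k=\begin{cases} m & \text{if } m \text{ is odd},\\ \frac m2 & \text{if } m\text{ is even},\end{cases}\qquad d=\begin{cases}3^{m-1}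 & \text{if } m\text{ is odd},\\ 3^{m-1}+3^{\frac m2-1} & \text{if } m\text{ is even}.\end{cases}$$ Moreover it has exactly one nonzero weight: every nonzero codeword has Hamming weight $d$. The code meets the Griesmer bound, that is, $n=\sum_{i=0}^{k-1}\left\lceil \frac{d}{3^i}\right\rceil$. -/

import Mathlib

open Polynomial

noncomputable section

/-- The `q`-cyclotomic coset of `s` modulo `n`, represented by integers in `{0, …, n - 1}`. -/
def cyclotomicCoset (q n s : ℕ) : Set ℕ := {t | ∃ i : ℕ, t = s * q ^ i % n}

/-- `s` is a coset leader modulo `n`: it lies in `{0, …, n - 1}` and is the smallest element of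
its own `q`-cyclotomic coset. -/
def IsCosetLeader (q n s : ℕ) : Prop := s < n ∧ IsLeast (cyclotomicCoset q n s) s

/-- The largest coset leader modulo `n` (denoted `δ₁`). -/
def largestCosetLeader (q n : ℕ) : ℕ := sSup {s | IsCosetLeader q n s}

/-- For `n > 0` the supremum in the definition of `largestCosetLeader` is a maximum. -/
theorem isGreatest_largestCosetLeader (q n : ℕ) (hn : 0 < n) :
    IsGreatest {s | IsCosetLeader q n s} (largestCosetLeader q n) := by
  have hb : BddAbove {s | IsCosetLeader q n s} := ⟨n, fun s hs => hs.1.le⟩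
  have hne : {s | IsCosetLeader q n s}.Nonempty :=
    ⟨0, hn, ⟨0, by simp⟩, fun _ _ => Nat.zero_le _⟩
  exact ⟨Nat.sSup_mem hne hb, fun _ hs => le_csSup hb hs⟩

open Classical in
/-- The (monic) least common multiple of a finite family of polynomials over a field. -/
def polyLcm {F : Type*} [Field F] (s : Finset ℕ) (f : ℕ → F[X]) : F[X] :=
  letI : NormalizedGCDMonoid F[X] := UniqueFactorizationMonoid.toNormalizedGCDMonoid F[X]
  s.lcm f

theorem polyLcm_dvd_iff {F : Type*} [Field F] (s : Finset ℕ) (f : ℕ → F[X]) (p : F[X]) :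
    polyLcm s f ∣ p ↔ ∀ i ∈ s, f i ∣ p := by
  classical
  let : NormalizedGCDMonoid F[X] := UniqueFactorizationMonoid.toNormalizedGCDMonoid F[X]
  exact Finset.lcm_dvd_iff

/-- The generator polynomial `g = lcm(m₁, …, m_{δ-1})` of the narrow-sense BCH code, where `mᵢ` is
the minimal polynomial over `F` of `β ^ i`. -/
def bchGenerator (F : Type*) {K : Type*} [Field F] [Field K] [Algebra F K] (β : K) (δ : ℕ) : F[X] :=
  polyLcm (Finset.Icc 1 (δ - 1)) (fun i => minpoly F (β ^ i))

/-- The polynomial `(x - 1) g(x)`. -/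
def evenLikeBchGenerator (F : Type*) {K : Type*} [Field F] [Field K] [Algebra F K]
    (β : K) (δ : ℕ) : F[X] :=
  (X - 1) * bchGenerator F β δ

/-- The identification of `(c₀, …, c_{n-1})` with the class of `c₀ + c₁ x + ⋯ + c_{n-1} x^{n-1}`
in `F[x] / (x^n - 1)`. -/
def toQuotient (F : Type*) [Field F] (n : ℕ) :
    (Fin n → F) →ₗ[F] AdjoinRoot (X ^ n - 1 : F[X]) :=
  Fintype.linearCombination F (fun i : Fin n => AdjoinRoot.root (X ^ n - 1 : F[X]) ^ (i : ℕ))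

/-- The cyclic code of length `n` over `F` corresponding to the ideal `⟨g⟩` of
`F[x] / (x^n - 1)`. -/
def cyclicCode {F : Type*} [Field F] (n : ℕ) (g : F[X]) : Submodule F (Fin n → F) :=
  ((Ideal.span {AdjoinRoot.mk (X ^ n - 1 : F[X]) g}).restrictScalars F).comap (toQuotient F n)

/-- The even-like subcode of the narrow-sense BCH code of length `n` and designed distance `δ`
over `F`, with respect to the root of unity `β`. -/
def evenLikeBchCode (F : Type*) {K : Type*} [Field F] [Field K] [Algebra F K]
    (n : ℕ) (β : K) (δ : ℕ) : Submodule F (Fin n → F) :=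
  cyclicCode n (evenLikeBchGenerator F β δ)

/-- `d` is the minimum Hamming distance between two distinct codewords of `C`. -/
def IsMinDistance {F : Type*} [Field F] [DecidableEq F] {n : ℕ} (C : Submodule F (Fin n → F))
    (d : ℕ) : Prop :=
  IsLeast {t | ∃ x ∈ C, ∃ y ∈ C, x ≠ y ∧ hammingDist x y = t} d

/-- `C`, a linear code of length `n` over `F`, is an `[n, k, d]` code. -/
def HasParameters {F : Type*} [Field F] [DecidableEq F] {n : ℕ} (C : Submodule F (Fin n → F))
    (k d : ℕ) : Prop :=
  Module.finrank F C = k ∧ IsMinDistance C d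

/-- The set of Hamming weights of the nonzero codewords of `C`. -/
def nonzeroWeights {F : Type*} [Field F] [DecidableEq F] {n : ℕ} (C : Submodule F (Fin n → F)) :
    Set ℕ :=
  {w | ∃ c ∈ C, c ≠ 0 ∧ hammingNorm c = w}

/-- The code attains equality in the Griesmer bound `n ≥ ∑_{i=0}^{k-1} ⌈d / q^i⌉`. -/
def MeetsGriesmerBound {F : Type*} [Field F] [Fintype F] [DecidableEq F] {n : ℕ}
    (C : Submodule F (Fin n → F)) : Prop :=
  ∃ k d : ℕ, HasParameters C k d ∧
    n = ∑ i ∈ Finset.range k, ⌈(d : ℚ) / (Fintype.card F : ℚ) ^ i⌉₊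

end

/-! Since `2n = 3^m - 1`, multiplication by 3 modulo `2n` rotates base-3 digits, and `s` is a coset
leader when `2n - 2s` is maximal among its rotations. The least such even number is `3^(m-1) +
3^⌊(m-1)/2⌋`, which gives `δ₁` (`two_mul_largestCosetLeader_three`).

Codewords vanish at `β^s` for every leader `s < δ₁`, so evaluation at `γ = β^δ₁` identifies the code
with the field `F[γ]` (`exists_linearEquiv_evenLikeBchCode`), and cyclic shift becomes
multiplication by `γ`. For odd `m`, `γ` has odd order `n` and its powers up to sign fill `K*`; for
even `m`, `γ` has order `3^(m/2) - 1` and its powers fill `F[γ]*`. Either way all nonzero codewords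
are shifts of one another up to sign, hence of equal weight, and counting nonzero entries by
coordinates (`sum_hammingNorm`) finds that weight. The Griesmer sum is then geometric, since every
quotient in it is an integer. -/

/-! ### The largest coset leader -/

/-- If `s` is a coset leader modulo `n`, then every representative
`ρ ≤ 2 n` of `(2 n - 2 s) q ^ i` modulo `2 n` is at most `2 n - 2 s`. -/
theorem IsCosetLeader.le_of_modEq {q n s : ℕ} (hs : IsCosetLeader q n s) {i ρ : ℕ}
    (hρn : ρ ≤ 2 * n) (h : ρ ≡ (2 * n - 2 * s) * q ^ i [MOD 2 * n]) :
    ρ ≤ 2 * n - 2 * s := by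
  obtain ⟨hsn, -, hmin⟩ := hs
  have hle : s ≤ s * q ^ i % n := hmin ⟨i, rfl⟩
  have hdvd : ((2 * n : ℕ) : ℤ) ∣ (2 * n - 2 * s : ℤ) * q ^ i - ρ := by
    have := (Nat.modEq_iff_dvd.1 h)
    rw [Nat.cast_mul _ (q ^ i), Nat.cast_sub (by omega)] at this
    push_cast at this ⊢
    exact this
  obtain ⟨e, he⟩ := hdvd
  push_cast at he
  have hx : ((s * q ^ i % n : ℕ) : ℤ) + n * (s * q ^ i / n : ℕ) = s * q ^ i := by
    exact_mod_cast Nat.mod_add_div (s * q ^ i) n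
  have hlt : s * q ^ i % n < n := Nat.mod_lt _ (by omega)
  set x : ℕ := s * q ^ i % n
  set y : ℕ := s * q ^ i / n
  -- A multiple of `2n` below `4n` is at most `2n`; then `s ≤ x` bounds `ρ`.
  have h2 : (ρ : ℤ) + 2 * x = 2 * n * (q ^ i - e - y) := by linear_combination 2 * hx - he
  have h3 : (q ^ i - e - y : ℤ) < 2 := by
    by_contra! hc
    have : (2 * n * 2 : ℤ) ≤ 2 * n * (q ^ i - e - y) := by gcongr
    omega
  have h4 : (2 * n * (q ^ i - e - y) : ℤ) ≤ 2 * n * 1 := by gcongr; omega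
  omega

theorem three_pow_modEq_one (m n : ℕ) (hn : 2 * n + 1 = 3 ^ m) : 3 ^ m ≡ 1 [MOD 2 * n] := by
  rw [← hn]; simp [Nat.ModEq]

/-- If `r = 2n - 2s` were smaller than claimed, it would be a leading digit 1 followed by a tail `r'
< 3^h`. Rotating the top digit of `r'` to the front carries the old leading 1 to position at least
`h`, which produces a rotation larger than `r`. -/
theorem IsCosetLeader.two_mul_add_le {m n s : ℕ} (hm : 2 ≤ m) (hn : 2 * n + 1 = 3 ^ m)
    (hs : IsCosetLeader 3 n s) : 2 * s + (3 ^ (m - 1) + 3 ^ ((m - 1) / 2)) ≤ 2 * n := by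
  have hsn : s < n := hs.1
  set h := (m - 1) / 2 with hh
  obtain ⟨r, hr⟩ : ∃ r, r = 2 * n - 2 * s := ⟨_, rfl⟩
  have key {i ρ : ℕ} := hs.le_of_modEq (i := i) (ρ := ρ)
  rw [← hr] at key
  have hpm : 3 ^ m = 3 * 3 ^ (m - 1) := by rw [← pow_succ']; congr 1; omega
  have hr1 : 3 ^ (m - 1) ≤ r := by
    by_contra! hc
    have := key (i := 1) (ρ := 3 * r) (by omega) (by rw [mul_comm 3, pow_one])
    omega
  by_contra! hlt
  have hodd : 3 ^ (m - 1) % 2 = 1 := by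
    rw [← Nat.odd_iff]; exact Odd.pow (by decide)
  obtain ⟨r', rfl⟩ : ∃ r', r = 3 ^ (m - 1) + r' := ⟨r - 3 ^ (m - 1), by omega⟩
  -- By parity: `r` is even and `3^(m-1)` is odd.
  have hr'0 : r' ≠ 0 := by omega
  have hr'h : r' < 3 ^ h := by omega
  set j := Nat.log 3 r' with hj
  have hj1 : 3 ^ j ≤ r' := Nat.pow_log_le_self 3 hr'0
  have hj2 : r' < 3 ^ (j + 1) := Nat.lt_pow_succ_log_self (by norm_num) r'
  have hjh : j < h := (Nat.pow_lt_pow_iff_right (by norm_num : 1 < 3)).1 (hj1.trans_lt hr'h)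
  -- `u` is where the leading digit lands after rotation by `m - 1 - j` places.
  set u := 3 ^ (m - 2 - j) with hu
  have hu1 : 3 ^ (m - 1 - j) = 3 * u := by rw [hu, ← pow_succ']; congr 1; omega
  have hupos : 0 < u := by positivity
  have hA : 3 ^ (j + 1) * (3 * u) = 3 ^ m := by rw [← hu1, ← pow_add]; congr 1; omega
  have hB : 3 ^ j * (3 * u) = 3 ^ (m - 1) := by rw [← hu1, ← pow_add]; congr 1; omega
  have hC : 3 ^ h ≤ u := Nat.pow_le_pow_right (by norm_num) (by omega)
  have h1 : (r' + 1) * (3 * u) ≤ 3 ^ m := by rw [← hA]; gcongr; omega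
  have h2 : 3 ^ (m - 1) ≤ r' * (3 * u) := by rw [← hB]; gcongr
  have := key (i := m - 1 - j) (ρ := u + r' * (3 * u)) (by rw [add_mul] at h1; omega) (by
    have e : (3 ^ (m - 1) + r') * 3 ^ (m - 1 - j) = 3 ^ m * u + r' * (3 * u) := by
      rw [hu1, hpm]; ring
    rw [e]
    simpa using (((three_pow_modEq_one m n hn).mul_right u).add_right (r' * (3 * u))).symm)
  omega

/-- Each rotation of `3^(m-1) + 3^h` is again a sum of two powers of 3. Either both exponents are at
most `m - 2`, or the larger is `m - 1` and the other is at most `h`. -/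
theorem isCosetLeader_three {m n s : ℕ} (hm : 3 ≤ m) (hn : 2 * n + 1 = 3 ^ m)
    (hs : 2 * s + (3 ^ (m - 1) + 3 ^ ((m - 1) / 2)) = 2 * n) : IsCosetLeader 3 n s := by
  set h := (m - 1) / 2 with hh
  have hn0 : 0 < n := by have := Nat.one_lt_pow (show m ≠ 0 by omega) (show 1 < 3 by norm_num); omega
  have hpos1 : 0 < 3 ^ (m - 1) := by positivity
  have hpos2 : 0 < 3 ^ h := by positivity
  have hsn : s < n := by omega
  have hone := three_pow_modEq_one m n hn
  have key (i : ℕ) : ∃ ρ, 0 < ρ ∧ ρ ≤ 3 ^ (m - 1) + 3 ^ h ∧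
      (3 ^ (m - 1) + 3 ^ h) * 3 ^ i ≡ ρ [MOD 2 * n] := by
    have hred : 3 ^ i ≡ 3 ^ (i % m) [MOD 2 * n] := by
      conv_lhs => rw [← Nat.div_add_mod i m, pow_add, pow_mul]
      simpa using (hone.pow (i / m)).mul_right (3 ^ (i % m))
    have him : i % m < m := Nat.mod_lt _ (by omega)
    set t := i % m
    suffices ∃ ρ, 0 < ρ ∧ ρ ≤ 3 ^ (m - 1) + 3 ^ h ∧
        (3 ^ (m - 1) + 3 ^ h) * 3 ^ t ≡ ρ [MOD 2 * n] by
      obtain ⟨ρ, h0, h1, h2⟩ := this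
      exact ⟨ρ, h0, h1, (hred.mul_left _).trans h2⟩
    have mono {a b : ℕ} (hab : a ≤ b) : 3 ^ a ≤ 3 ^ b := Nat.pow_le_pow_right (by norm_num) hab
    have hm1 : 3 ^ (m - 1) = 3 * 3 ^ (m - 2) := by rw [← pow_succ']; congr 1; omega
    rcases Nat.eq_zero_or_pos t with ht | ht
    · exact ⟨_, by positivity, le_rfl, by rw [ht]; simp [Nat.ModEq]⟩
    have e1 : 3 ^ (m - 1) * 3 ^ t = 3 ^ m * 3 ^ (t - 1) := by
      rw [← pow_add, ← pow_add]; congr 1; omega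
    have c1 : 3 ^ (m - 1) * 3 ^ t ≡ 3 ^ (t - 1) [MOD 2 * n] := by
      rw [e1]; simpa using hone.mul_right (3 ^ (t - 1))
    by_cases hht : h + t < m
    · refine ⟨3 ^ (t - 1) + 3 ^ (h + t), by positivity, ?_, ?_⟩
      · rcases Nat.lt_or_ge (h + t) (m - 1) with hlt | hge
        · have := mono (show h + t ≤ m - 2 by omega)
          have := mono (show t - 1 ≤ m - 2 by omega)
          omega
        · have := mono (show h + t ≤ m - 1 by omega)
          have := mono (show t - 1 ≤ h by omega)
          omega
      · rw [add_mul, ← pow_add 3 h]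
        exact c1.add_right _
    · refine ⟨3 ^ (t - 1) + 3 ^ (h + t - m), by positivity, ?_, ?_⟩
      · have := mono (show h + t - m ≤ m - 2 by omega)
        have := mono (show t - 1 ≤ m - 2 by omega)
        omega
      · rw [add_mul]
        refine c1.add ?_
        have e2 : 3 ^ h * 3 ^ t = 3 ^ m * 3 ^ (h + t - m) := by
          rw [← pow_add, ← pow_add]; congr 1; omega
        rw [e2]; simpa using hone.mul_right (3 ^ (h + t - m))
  refine ⟨hsn, ⟨0, by simp [Nat.mod_eq_of_lt hsn]⟩, ?_⟩
  rintro x ⟨i, rfl⟩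
  obtain ⟨ρ, hρ0, hρ1, hρ⟩ := key i
  have h1 : 2 * (s * 3 ^ i % n) ≡ 2 * (s * 3 ^ i) [MOD 2 * n] :=
    (Nat.mod_modEq _ n).mul_left' 2
  have h2 : 2 * (s * 3 ^ i % n) + ρ ≡ 0 [MOD 2 * n] := by
    refine (h1.add hρ.symm).trans ?_
    rw [show 2 * (s * 3 ^ i) + (3 ^ (m - 1) + 3 ^ h) * 3 ^ i
      = (2 * s + (3 ^ (m - 1) + 3 ^ h)) * 3 ^ i by ring]
    rw [hs]
    simp [Nat.ModEq]
  -- Positivity of `ρ` excludes the multiple 0, so the sum is at least `2n`.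
  have := Nat.le_of_dvd (by omega) ((Nat.modEq_zero_iff_dvd).1 h2)
  omega

theorem two_mul_largestCosetLeader_three {m n : ℕ} (hm : 3 ≤ m) (hn : 2 * n + 1 = 3 ^ m) :
    2 * largestCosetLeader 3 n + (3 ^ (m - 1) + 3 ^ ((m - 1) / 2)) = 2 * n := by
  have hn0 : 0 < n := by
    have := Nat.one_lt_pow (show m ≠ 0 by omega) (show 1 < 3 by norm_num)
    omega
  obtain ⟨hmem, hub⟩ := isGreatest_largestCosetLeader 3 n hn0
  have h1 := IsCosetLeader.two_mul_add_le (by omega) hn hmem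
  have o1 : 3 ^ (m - 1) % 2 = 1 := by rw [← Nat.odd_iff]; exact Odd.pow (by decide)
  have o2 : 3 ^ ((m - 1) / 2) % 2 = 1 := by rw [← Nat.odd_iff]; exact Odd.pow (by decide)
  have h2 : n - (3 ^ (m - 1) + 3 ^ ((m - 1) / 2)) / 2 ≤ largestCosetLeader 3 n :=
    hub (isCosetLeader_three hm hn (by omega))
  omega

/-! ### Evaluation, cyclic shifts and Frobenius -/

/-- Evaluation of the word `(c₀, …, c_{n-1})`, seen as the polynomial `∑ cᵢ xⁱ`, at `x`. -/
def wordEval (F : Type*) {K : Type*} [Field F] [Field K] [Algebra F K] (n : ℕ) (x : K) :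
    (Fin n → F) →ₗ[F] K :=
  Fintype.linearCombination F (fun i : Fin n => x ^ (i : ℕ))

/-- The cyclic shift of a word by `k` positions. -/
def cyclicShift {F : Type*} {n : ℕ} (k : Fin n) (c : Fin n → F) : Fin n → F :=
  fun j => c (j - k)

section

variable {F K : Type*} [Field F] [Field K] [Algebra F K]

theorem wordEval_apply (n : ℕ) (x : K) (c : Fin n → F) :
    wordEval F n x c = ∑ i, c i • x ^ (i : ℕ) := rfl

theorem wordEval_eq_aeval {n : ℕ} {x : K} (hx : x ^ n = 1) {c : Fin n → F} {f : F[X]}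
    (h : toQuotient F n c = AdjoinRoot.mk _ f) : wordEval F n x c = aeval x f := by
  let φ : AdjoinRoot (X ^ n - 1 : F[X]) →ₐ[F] K :=
    AdjoinRoot.liftAlgHom _ (Algebra.ofId F K) x (by simp [hx])
  have hr : φ (AdjoinRoot.root _) = x := by simp [φ]
  have h1 : φ (toQuotient F n c) = wordEval F n x c := by
    simp [toQuotient, wordEval_apply, Fintype.linearCombination_apply, map_sum, hr]
  rw [← h1, h, ← AdjoinRoot.aeval_eq, ← aeval_algHom_apply, hr]

theorem toQuotient_surjective {n : ℕ} (hn : 0 < n) : Function.Surjective (toQuotient F n) := by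
  intro z
  obtain ⟨f, rfl⟩ := AdjoinRoot.mk_surjective z
  have hmon : (X ^ n - 1 : F[X]).Monic := by
    simpa using monic_X_pow_sub_C (1 : F) hn.ne'
  have hdeg : (X ^ n - 1 : F[X]).natDegree = n := by
    simpa using natDegree_X_pow_sub_C (n := n) (r := (1 : F))
  set p := f %ₘ (X ^ n - 1 : F[X]) with hp
  have hpn : p.natDegree < n := by
    have := natDegree_modByMonic_lt f hmon (by rintro h; rw [h] at hdeg; simp at hdeg; omega)
    rwa [hdeg] at this
  have hfp : AdjoinRoot.mk (X ^ n - 1 : F[X]) f = AdjoinRoot.mk _ p := by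
    conv_lhs => rw [← modByMonic_add_div f (X ^ n - 1 : F[X])]
    simp [hp]
  refine ⟨fun i => p.coeff i, ?_⟩
  rw [hfp, ← AdjoinRoot.aeval_eq, aeval_eq_sum_range' hpn, Finset.sum_range]
  rfl

theorem mem_cyclicCode {n : ℕ} {g : F[X]} {c : Fin n → F} :
    c ∈ cyclicCode n g ↔ ∃ f, toQuotient F n c = AdjoinRoot.mk _ (g * f) := by
  rw [cyclicCode, Submodule.mem_comap, Submodule.restrictScalars_mem,
    Ideal.mem_span_singleton']
  constructor
  · rintro ⟨a, ha⟩
    obtain ⟨f, rfl⟩ := AdjoinRoot.mk_surjective a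
    exact ⟨f, by rw [← ha, map_mul, mul_comm]⟩
  · rintro ⟨f, hf⟩
    exact ⟨AdjoinRoot.mk _ f, by rw [hf, map_mul, mul_comm]⟩

theorem pow_val_add {M : Type*} [Monoid M] {n : ℕ} {x : M} (hx : x ^ n = 1) (j k : Fin n) :
    x ^ ((j + k : Fin n) : ℕ) = x ^ (j : ℕ) * x ^ (k : ℕ) := by
  rw [Fin.val_add, ← pow_add]
  conv_rhs => rw [← Nat.div_add_mod (j + k : ℕ) n, pow_add, pow_mul, hx, one_pow, one_mul]

/-- A general algebra `A` serves two uses: the quotient ring, for shift invariance of the code, and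
`K`, for evaluation. -/
theorem sum_cyclicShift {A : Type*} [CommRing A] [Algebra F A] {n : ℕ} {x : A} (hx : x ^ n = 1)
    (k : Fin n) (c : Fin n → F) :
    ∑ i, cyclicShift k c i • x ^ (i : ℕ) = x ^ (k : ℕ) * ∑ i, c i • x ^ (i : ℕ) := by
  have : NeZero n := ⟨by have := k.isLt; omega⟩
  rw [← Equiv.sum_comp (Equiv.addRight k), Finset.mul_sum]
  refine Finset.sum_congr rfl fun i _ => ?_
  rw [Equiv.coe_addRight, pow_val_add hx, cyclicShift, add_sub_cancel_right, mul_smul_comm,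
    mul_comm]

theorem root_pow_eq_one (n : ℕ) : AdjoinRoot.root (X ^ n - 1 : F[X]) ^ n = 1 := by
  have := AdjoinRoot.mk_self (f := (X ^ n - 1 : F[X]))
  rwa [map_sub, map_pow, map_one, AdjoinRoot.mk_X, sub_eq_zero] at this

theorem cyclicShift_mem {n : ℕ} {g : F[X]} {c : Fin n → F} (hc : c ∈ cyclicCode n g) (k : Fin n) :
    cyclicShift k c ∈ cyclicCode n g := by
  rw [mem_cyclicCode] at hc ⊢
  obtain ⟨f, hf⟩ := hc
  refine ⟨f * X ^ (k : ℕ), ?_⟩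
  have := sum_cyclicShift (root_pow_eq_one (F := F) n) k c
  change toQuotient F n (cyclicShift k c) = _ * toQuotient F n c at this
  rw [this, hf]
  simp only [map_mul, map_pow, AdjoinRoot.mk_X]
  ring

theorem wordEval_cyclicShift {n : ℕ} {x : K} (hx : x ^ n = 1) (k : Fin n) (c : Fin n → F) :
    wordEval F n x (cyclicShift k c) = x ^ (k : ℕ) * wordEval F n x c :=
  sum_cyclicShift hx k c

theorem hammingNorm_cyclicShift [DecidableEq F] {n : ℕ} (k : Fin n) (c : Fin n → F) :
    hammingNorm (cyclicShift k c) = hammingNorm c := by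
  have : NeZero n := ⟨by have := k.isLt; omega⟩
  exact Finset.card_equiv (Equiv.subRight k) fun i => by
    rw [Finset.mem_filter, Finset.mem_filter]
    simp [cyclicShift]

theorem hammingNorm_neg_word [DecidableEq F] {n : ℕ} (c : Fin n → F) :
    hammingNorm (-c) = hammingNorm c := by
  simp [hammingNorm]

theorem polyLcm_dvd_prod {s : Finset ℕ} {f : ℕ → F[X]} : polyLcm s f ∣ ∏ i ∈ s, f i :=
  (polyLcm_dvd_iff _ _ _).2 fun _ hi => Finset.dvd_prod_of_mem f hi

theorem dvd_polyLcm {s : Finset ℕ} {f : ℕ → F[X]} {i : ℕ} (hi : i ∈ s) : f i ∣ polyLcm s f :=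
  (polyLcm_dvd_iff _ _ _).1 dvd_rfl i hi

variable [Fintype F]

theorem aeval_pow_card_pow (f : F[X]) (x : K) (l : ℕ) :
    aeval (x ^ Fintype.card F ^ l) f = aeval x f ^ Fintype.card F ^ l := by
  have h (y : K) : (FiniteField.frobeniusAlgHom F K ^ l) y = y ^ Fintype.card F ^ l := by
    rw [AlgHom.coe_pow, FiniteField.coe_frobeniusAlgHom, pow_iterate]
  rw [← h, ← h, aeval_algHom_apply]

/-- Conjugates differ by an automorphism, and all automorphisms are Frobenius powers. -/
theorem exists_eq_pow_of_aeval_minpoly [Finite K] {x y : K} (h : aeval y (minpoly F x) = 0) :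
    ∃ l, y ^ Fintype.card F ^ l = x := by
  obtain ⟨σ, rfl⟩ := minpoly.exists_algEquiv_of_root (Algebra.IsAlgebraic.isAlgebraic x) h
  obtain ⟨l, hl⟩ := (FiniteField.bijective_frobeniusAlgHom_pow F K).2 (σ : K →ₐ[F] K)
  refine ⟨l, ?_⟩
  have := congrArg (fun φ : K →ₐ[F] K => φ y) hl
  simp only [AlgHom.coe_pow, FiniteField.coe_frobeniusAlgHom, pow_iterate] at this
  exact this

end

/-! ### The code as the field generated by one root -/

theorem exists_isCosetLeader {q n : ℕ} (hn : 0 < n) (j : ℕ) :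
    ∃ s l, IsCosetLeader q n s ∧ s = j * q ^ l % n := by
  have hne : (cyclotomicCoset q n j).Nonempty := ⟨_, 0, rfl⟩
  obtain ⟨l, hl⟩ := Nat.sInf_mem hne
  refine ⟨sInf (cyclotomicCoset q n j), l, ⟨hl ▸ Nat.mod_lt _ hn, ⟨0, ?_⟩, ?_⟩, hl⟩
  · rw [hl]; simp
  · rintro x ⟨i, rfl⟩
    refine Nat.sInf_le ⟨l + i, ?_⟩
    conv_lhs => rw [hl]
    rw [pow_add, ← mul_assoc, Nat.mod_mul_mod]

section

variable {F K : Type*} [Field F] [Field K] [Algebra F K] {n : ℕ} {β : K}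

theorem wordEval_eq_zero_of_lt {δ s : ℕ} (hβ : IsPrimitiveRoot β n) {c : Fin n → F}
    (hc : c ∈ evenLikeBchCode F n β δ) (hs : s < δ) : wordEval F n (β ^ s) c = 0 := by
  obtain ⟨f, hf⟩ := mem_cyclicCode.1 hc
  rw [wordEval_eq_aeval (by rw [pow_right_comm, hβ.pow_eq_one, one_pow]) hf, map_mul,
    evenLikeBchGenerator, map_mul]
  rcases Nat.eq_zero_or_pos s with rfl | hs0
  · simp
  · have : minpoly F (β ^ s) ∣ bchGenerator F β δ := dvd_polyLcm (by simp; omega)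
    rw [aeval_eq_zero_of_dvd_aeval_eq_zero this (minpoly.aeval _ _)]
    simp

variable [Fintype F]

/-- The word vanishes at `β^s` for every leader `s`, hence by Frobenius at all `n`-th roots of
unity; the Vandermonde matrix then forces it to be zero. -/
theorem eq_zero_of_mem_evenLikeBchCode (hn : 0 < n) (hβ : IsPrimitiveRoot β n) {c : Fin n → F}
    (hc : c ∈ evenLikeBchCode F n β (largestCosetLeader (Fintype.card F) n))
    (h0 : wordEval F n (β ^ largestCosetLeader (Fintype.card F) n) c = 0) : c = 0 := by
  have key (j : Fin n) : wordEval F n (β ^ (j : ℕ)) c = 0 := by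
    obtain ⟨s, l, hs, hl⟩ := exists_isCosetLeader (q := Fintype.card F) hn j
    have hs0 : wordEval F n (β ^ s) c = 0 := by
      rcases ((isGreatest_largestCosetLeader _ n hn).2 hs).lt_or_eq with h | h
      · exact wordEval_eq_zero_of_lt hβ hc h
      · rw [h, h0]
    have hpow : β ^ s = (β ^ (j : ℕ)) ^ Fintype.card F ^ l := by
      rw [hl, ← pow_mul, ← pow_eq_pow_mod _ hβ.pow_eq_one]
    obtain ⟨f, hf⟩ := mem_cyclicCode.1 hc
    have h1 (i : ℕ) : (β ^ i) ^ n = 1 := by rw [pow_right_comm, hβ.pow_eq_one, one_pow]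
    rw [wordEval_eq_aeval (h1 _) hf] at hs0 ⊢
    rw [hpow, aeval_pow_card_pow] at hs0
    exact eq_zero_of_pow_eq_zero hs0
  have hinj : Function.Injective fun j : Fin n => β ^ (j : ℕ) := fun i j h =>
    Fin.ext (hβ.pow_inj i.2 j.2 h)
  have := Matrix.eq_zero_of_forall_index_sum_pow_mul_eq_zero (v := fun i => algebraMap F K (c i))
    hinj fun j => by
      rw [← key j, wordEval_apply]
      exact Finset.sum_congr rfl fun i _ => by rw [Algebra.smul_def, mul_comm]
  funext i
  simpa using congrFun this i

variable [Finite K]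

/-- A vanishing factor `mᵢ` with `i < δ₁` would put `i` in the coset of `δ₁`, against minimality of
the leader; `x - 1` does not vanish because `0 < δ₁ < n`. -/
theorem aeval_evenLikeBchGenerator_ne_zero (hn : 0 < n) (hβ : IsPrimitiveRoot β n)
    (hδ : largestCosetLeader (Fintype.card F) n ≠ 0) :
    aeval (β ^ largestCosetLeader (Fintype.card F) n)
      (evenLikeBchGenerator F β (largestCosetLeader (Fintype.card F) n)) ≠ 0 := by
  obtain ⟨⟨hlt, -, hmin⟩, -⟩ := isGreatest_largestCosetLeader (Fintype.card F) n hn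
  set δ := largestCosetLeader (Fintype.card F) n
  rw [evenLikeBchGenerator, map_mul]
  refine mul_ne_zero ?_ fun h => ?_
  · simpa [sub_eq_zero] using fun h => hδ (hβ.pow_inj hlt hn (by simpa using h))
  · have := aeval_eq_zero_of_dvd_aeval_eq_zero polyLcm_dvd_prod h
    rw [map_prod, Finset.prod_eq_zero_iff] at this
    obtain ⟨i, hi, hi0⟩ := this
    rw [Finset.mem_Icc] at hi
    obtain ⟨l, hl⟩ := exists_eq_pow_of_aeval_minpoly hi0
    rw [← pow_mul, pow_eq_pow_mod _ hβ.pow_eq_one] at hl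
    have := hβ.pow_inj (Nat.mod_lt _ hn) (by omega) hl
    have := hmin ⟨l, this.symm⟩
    omega

theorem exists_linearEquiv_evenLikeBchCode (hn : 0 < n) (hβ : IsPrimitiveRoot β n) {δ : ℕ}
    (hδ : δ = largestCosetLeader (Fintype.card F) n) (hδ0 : δ ≠ 0) :
    ∃ e : evenLikeBchCode F n β δ ≃ₗ[F] Algebra.adjoin F {β ^ δ},
      ∀ c, (e c : K) = wordEval F n (β ^ δ) c := by
  have hγ : (β ^ δ) ^ n = 1 := by rw [pow_right_comm, hβ.pow_eq_one, one_pow]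
  let φ : evenLikeBchCode F n β δ →ₗ[F] Algebra.adjoin F {β ^ δ} :=
    ((wordEval F n (β ^ δ)).comp (evenLikeBchCode F n β δ).subtype).codRestrict
      (Algebra.adjoin F {β ^ δ}).toSubmodule fun c => by
        simp only [LinearMap.comp_apply, wordEval_apply]
        exact Submodule.sum_mem _ fun i _ => Submodule.smul_mem _ _
          (pow_mem (Algebra.self_mem_adjoin_singleton F (β ^ δ)) _)
  have hφ (c) : (φ c : K) = wordEval F n (β ^ δ) c := rfl
  refine ⟨LinearEquiv.ofBijective φ ⟨?_, ?_⟩, hφ⟩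
  · rw [injective_iff_map_eq_zero]
    intro c hc
    subst hδ
    refine Subtype.ext (eq_zero_of_mem_evenLikeBchCode hn hβ c.2 ?_)
    rw [← hφ, hc]
    rfl
  · rintro ⟨y, hy⟩
    have hg0 : aeval (β ^ δ) (evenLikeBchGenerator F β δ) ≠ 0 := by
      subst hδ
      exact aeval_evenLikeBchGenerator_ne_zero hn hβ hδ0
    -- For surjectivity, the cofactor of the generator must take the value `y / g̃(β^δ)`, which
    -- stays in `F[β^δ]` by algebraicity.
    have hmem : (aeval (β ^ δ) (evenLikeBchGenerator F β δ))⁻¹ * y ∈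
        Algebra.adjoin F {β ^ δ} := by
      refine mul_mem (Subalgebra.inv_mem_of_algebraic (x := ⟨_, aeval_mem_adjoin_singleton F _⟩) _
        (Algebra.IsAlgebraic.isAlgebraic _)) hy
    rw [Algebra.adjoin_singleton_eq_range_aeval] at hmem
    obtain ⟨p, hp⟩ := hmem
    obtain ⟨c, hc⟩ := toQuotient_surjective hn
      (AdjoinRoot.mk (X ^ n - 1 : F[X]) (evenLikeBchGenerator F β δ * p))
    refine ⟨⟨c, mem_cyclicCode.2 ⟨p, hc⟩⟩, Subtype.ext ?_⟩
    change wordEval F n (β ^ δ) c = y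
    rw [wordEval_eq_aeval hγ hc, map_mul]
    rw [show aeval (β ^ δ) p = _ from hp, mul_inv_cancel_left₀ hg0]

end

/-! ### Constant weight by double counting -/

/-- Each coordinate is a nonzero functional, so it vanishes exactly on a hyperplane of the code. -/
theorem sum_hammingNorm {F : Type*} [Field F] [Fintype F] [DecidableEq F] {n : ℕ}
    (C : Submodule F (Fin n → F)) [Fintype C] (h : ∀ j, ∃ c ∈ C, c j ≠ 0) :
    ∑ c : C, hammingNorm (c : Fin n → F) = n * (Fintype.card F ^ Module.finrank F C -
      Fintype.card F ^ (Module.finrank F C - 1)) := by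
  have h1 (j : Fin n) : (Finset.univ.filter fun c : C => (c : Fin n → F) j ≠ 0).card =
      Fintype.card F ^ Module.finrank F C - Fintype.card F ^ (Module.finrank F C - 1) := by
    classical
    let f : C →ₗ[F] F := (LinearMap.proj j).comp C.subtype
    have hf : f ≠ 0 := by
      obtain ⟨c, hc, hcj⟩ := h j
      exact fun h0 => hcj (congrArg (fun g : C →ₗ[F] F => g ⟨c, hc⟩) h0)
    have hker : (Finset.univ.filter fun c : C => (c : Fin n → F) j = 0).card =
        Fintype.card F ^ (Module.finrank F C - 1) := by
      rw [← Module.Dual.finrank_ker_add_one_of_ne_zero hf, Nat.add_sub_cancel,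
        ← Module.card_eq_pow_finrank (K := F) (V := LinearMap.ker f), Fintype.card_subtype]
      congr 1
      ext c
      simp [f]
    rw [← hker, ← Module.card_eq_pow_finrank, ← Finset.card_univ,
      ← Finset.card_filter_add_card_filter_not (s := (Finset.univ : Finset C))
        (fun c : C => (c : Fin n → F) j = 0), Nat.add_sub_cancel_left]
  calc ∑ c : C, hammingNorm (c : Fin n → F)
      = ∑ c : C, ∑ j, if (c : Fin n → F) j ≠ 0 then 1 else 0 := by
        simp only [hammingNorm, Finset.card_filter]
    _ = ∑ j, (Finset.univ.filter fun c : C => (c : Fin n → F) j ≠ 0).card := by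
        simp only [Finset.card_filter]; exact Finset.sum_comm
    _ = _ := by simp [h1]

theorem hasParameters_of_hammingNorm_eq {F : Type*} [Field F] [DecidableEq F] {n : ℕ}
    {C : Submodule F (Fin n → F)} {k d : ℕ}
    (hk : Module.finrank F C = k) (hk0 : k ≠ 0) (hd : ∀ c ∈ C, c ≠ 0 → hammingNorm c = d) :
    HasParameters C k d ∧ nonzeroWeights C = {d} := by
  have hne : C ≠ ⊥ := by
    rintro rfl
    simp at hk
    omega
  obtain ⟨c, hc, hc0⟩ := C.ne_bot_iff.1 hne
  refine ⟨⟨hk, ⟨0, C.zero_mem, c, hc, hc0.symm, ?_⟩, ?_⟩, ?_⟩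
  · rw [hammingDist_zero_left, hd c hc hc0]
  · rintro t ⟨x, hx, y, hy, hxy, rfl⟩
    rw [hammingDist_eq_hammingNorm, hd _ (add_mem (neg_mem hx) hy)]
    rwa [Ne, neg_add_eq_zero]
  · ext w
    constructor
    · rintro ⟨x, hx, hx0, rfl⟩
      exact hd x hx hx0
    · rintro rfl
      exact ⟨c, hc, hc0, hd c hc hc0⟩

section

variable {F K : Type*} [Field F] [Fintype F] [Field K] [Algebra F K] [Finite K]
  {n : ℕ} {β : K}

theorem exists_cyclicShift_eq (hn : 0 < n) (hβ : IsPrimitiveRoot β n) {δ : ℕ}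
    (hδ : δ = largestCosetLeader (Fintype.card F) n) (hδ0 : δ ≠ 0)
    (hgen : ∀ z ∈ Algebra.adjoin F {β ^ δ}, z ≠ 0 → ∃ j, z = (β ^ δ) ^ j ∨ z = -(β ^ δ) ^ j)
    {c c' : Fin n → F} (hc : c ∈ evenLikeBchCode F n β δ) (hc' : c' ∈ evenLikeBchCode F n β δ)
    (h0 : c ≠ 0) (h0' : c' ≠ 0) : ∃ k, c' = cyclicShift k c ∨ c' = -cyclicShift k c := by
  obtain ⟨e, he⟩ := exists_linearEquiv_evenLikeBchCode (F := F) hn hβ hδ hδ0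
  have hγ : (β ^ δ) ^ n = 1 := by rw [pow_right_comm, hβ.pow_eq_one, one_pow]
  have hmem {x} (hx : x ∈ evenLikeBchCode F n β δ) :
      wordEval F n (β ^ δ) x ∈ Algebra.adjoin F {β ^ δ} := by
    rw [← he ⟨x, hx⟩]; exact Subtype.prop _
  have inj {x} (hx : x ∈ evenLikeBchCode F n β δ) (h : wordEval F n (β ^ δ) x = 0) : x = 0 := by
    rw [← he ⟨x, hx⟩, ZeroMemClass.coe_eq_zero, LinearEquiv.map_eq_zero_iff] at h
    exact congrArg Subtype.val h
  have hne : wordEval F n (β ^ δ) c ≠ 0 := fun h => h0 (inj hc h)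
  have hne' : wordEval F n (β ^ δ) c' ≠ 0 := fun h => h0' (inj hc' h)
  obtain ⟨j, hj⟩ := hgen (wordEval F n (β ^ δ) c' * (wordEval F n (β ^ δ) c)⁻¹)
    (mul_mem (hmem hc') (Subalgebra.inv_mem_of_algebraic (x := ⟨_, hmem hc⟩) _
      (Algebra.IsAlgebraic.isAlgebraic _))) (mul_ne_zero hne' (inv_ne_zero hne))
  let k : Fin n := ⟨j % n, Nat.mod_lt _ hn⟩
  have hk : (β ^ δ) ^ (k : ℕ) = (β ^ δ) ^ j := (pow_eq_pow_mod j hγ).symm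
  rw [← hk] at hj
  refine ⟨k, hj.imp (fun h => ?_) fun h => ?_⟩ <;> rw [mul_inv_eq_iff_eq_mul₀ hne] at h
  · refine sub_eq_zero.1 (inj (sub_mem hc' (cyclicShift_mem hc k)) ?_)
    rw [map_sub, wordEval_cyclicShift hγ, h, sub_self]
  · refine add_eq_zero_iff_eq_neg.1 (inj (add_mem hc' (cyclicShift_mem hc k)) ?_)
    rw [map_add, wordEval_cyclicShift hγ, h]
    ring

variable [DecidableEq F]

theorem hammingNorm_mul_eq (hn : 0 < n) (hβ : IsPrimitiveRoot β n) {δ k : ℕ}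
    (hδ : δ = largestCosetLeader (Fintype.card F) n) (hδ0 : δ ≠ 0)
    (hgen : ∀ z ∈ Algebra.adjoin F {β ^ δ}, z ≠ 0 → ∃ j, z = (β ^ δ) ^ j ∨ z = -(β ^ δ) ^ j)
    (hk : Module.finrank F (evenLikeBchCode F n β δ) = k)
    {c : Fin n → F} (hc : c ∈ evenLikeBchCode F n β δ) (h0 : c ≠ 0) :
    (Fintype.card F ^ k - 1) * hammingNorm c =
      n * (Fintype.card F ^ k - Fintype.card F ^ (k - 1)) := by
  classical
  have : NeZero n := ⟨hn.ne'⟩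
  have : Fintype (evenLikeBchCode F n β δ) := Fintype.ofFinite _
  have hw (c' : evenLikeBchCode F n β δ) (h : c' ≠ 0) :
      hammingNorm (c' : Fin n → F) = hammingNorm c := by
    obtain ⟨i, hi | hi⟩ := exists_cyclicShift_eq hn hβ hδ hδ0 hgen hc c'.2 h0
      (by simpa using h)
    · rw [hi, hammingNorm_cyclicShift]
    · rw [hi, hammingNorm_neg_word, hammingNorm_cyclicShift]
  have hcoord (j : Fin n) : ∃ c ∈ evenLikeBchCode F n β δ, c j ≠ 0 := by
    obtain ⟨i, hi⟩ := Function.ne_iff.1 h0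
    -- Shifting by `j - i` moves the nonzero entry from `i` to `j`.
    exact ⟨_, cyclicShift_mem hc (j - i), by simpa [cyclicShift] using hi⟩
  rw [← hk, ← sum_hammingNorm _ hcoord, ← Module.card_eq_pow_finrank,
    ← Finset.sum_erase (a := 0) _ (by simp),
    Finset.sum_congr rfl fun x hx => hw x (Finset.ne_of_mem_erase hx), Finset.sum_const,
    Finset.card_erase_of_mem (Finset.mem_univ _), Finset.card_univ, smul_eq_mul]

theorem evenLikeBchCode_hasParameters (hn : 0 < n) (hβ : IsPrimitiveRoot β n) {δ k d : ℕ}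
    (hδ : δ = largestCosetLeader (Fintype.card F) n) (hδ0 : δ ≠ 0)
    (hgen : ∀ z ∈ Algebra.adjoin F {β ^ δ}, z ≠ 0 → ∃ j, z = (β ^ δ) ^ j ∨ z = -(β ^ δ) ^ j)
    (hk : Nat.card (Algebra.adjoin F {β ^ δ}) = Fintype.card F ^ k) (hk0 : k ≠ 0)
    (hd : (Fintype.card F ^ k - 1) * d = n * (Fintype.card F ^ k - Fintype.card F ^ (k - 1))) :
    HasParameters (evenLikeBchCode F n β δ) k d ∧
      nonzeroWeights (evenLikeBchCode F n β δ) = {d} := by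
  have hfr : Module.finrank F (evenLikeBchCode F n β δ) = k := by
    obtain ⟨e, -⟩ := exists_linearEquiv_evenLikeBchCode (F := F) hn hβ hδ hδ0
    rw [e.finrank_eq]
    rw [Module.natCard_eq_pow_finrank (K := F), Nat.card_eq_fintype_card] at hk
    exact Nat.pow_right_injective Fintype.one_lt_card hk
  refine hasParameters_of_hammingNorm_eq hfr hk0 fun c hc h0 => ?_
  have h1 : 1 < Fintype.card F ^ k := Nat.one_lt_pow hk0 Fintype.one_lt_card
  refine Nat.eq_of_mul_eq_mul_left (Nat.sub_pos_of_lt h1) ?_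
  rw [hd]
  exact hammingNorm_mul_eq hn hβ hδ hδ0 hgen hfr hc h0

end

/-! ### Fields generated by a primitive root of unity -/

section

variable {F K : Type*} [Field F] [Fintype F] [Field K] [Algebra F K]

theorem pow_card_pow_eq_self_of_mem_adjoin {γ : K} {k : ℕ} (hγ : γ ^ Fintype.card F ^ k = γ)
    {z : K} (hz : z ∈ Algebra.adjoin F {γ}) : z ^ Fintype.card F ^ k = z := by
  rw [Algebra.adjoin_singleton_eq_range_aeval] at hz
  obtain ⟨p, rfl⟩ := hz
  change aeval γ p ^ _ = aeval γ p
  rw [← aeval_pow_card_pow, hγ]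

theorem exists_pow_eq_of_mem_adjoin {γ : K} {k : ℕ} (hk : k ≠ 0)
    (hγ : IsPrimitiveRoot γ (Fintype.card F ^ k - 1)) {z : K} (hz : z ∈ Algebra.adjoin F {γ})
    (hz0 : z ≠ 0) : ∃ j < Fintype.card F ^ k - 1, γ ^ j = z := by
  have h1 : 1 < Fintype.card F ^ k := Nat.one_lt_pow hk Fintype.one_lt_card
  have : NeZero (Fintype.card F ^ k - 1) := ⟨by omega⟩
  have hs (x : K) : x ^ Fintype.card F ^ k = x ^ (Fintype.card F ^ k - 1) * x := by
    rw [← pow_succ]; congr 1; omega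
  refine hγ.eq_pow_of_pow_eq_one (mul_right_cancel₀ hz0 ?_)
  rw [← hs, pow_card_pow_eq_self_of_mem_adjoin (by rw [hs, hγ.pow_eq_one, one_mul]) hz, one_mul]

theorem card_adjoin_eq {γ : K} {k : ℕ} (hk : k ≠ 0)
    (hγ : IsPrimitiveRoot γ (Fintype.card F ^ k - 1)) :
    Nat.card (Algebra.adjoin F {γ}) = Fintype.card F ^ k := by
  classical
  have h1 : 1 < Fintype.card F ^ k := Nat.one_lt_pow hk Fintype.one_lt_card
  have hγ0 : γ ≠ 0 := hγ.ne_zero (by omega)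
  have hset : (Algebra.adjoin F {γ} : Set K) =
      (insert 0 ((Finset.range (Fintype.card F ^ k - 1)).image (γ ^ ·)) : Finset K) := by
    ext z
    simp only [SetLike.mem_coe, Finset.mem_insert, Finset.mem_image, Finset.mem_range]
    constructor
    · intro hz
      by_cases hz0 : z = 0
      · exact Or.inl hz0
      · exact Or.inr (exists_pow_eq_of_mem_adjoin hk hγ hz hz0)
    · rintro (rfl | ⟨j, -, rfl⟩)
      · exact zero_mem _
      · exact pow_mem (Algebra.self_mem_adjoin_singleton F γ) _
  change Nat.card (Algebra.adjoin F {γ} : Set K) = _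
  rw [hset, Nat.card_eq_card_toFinset, Finset.toFinset_coe, Finset.card_insert_of_notMem,
    Finset.card_image_of_injOn, Finset.card_range]
  · omega
  · intro i hi j hj h
    exact hγ.pow_inj (by simpa using hi) (by simpa using hj) h
  · simp [hγ0]

end

/-! ### The Griesmer sums -/

theorem three_pow_div_three_pow {a i : ℕ} (h : i ≤ a) : (3 : ℚ) ^ a / 3 ^ i = (3 ^ (a - i) : ℕ) := by
  push_cast
  rw [div_eq_iff (by positivity), ← pow_add, Nat.sub_add_cancel h]

theorem two_mul_sum_three_pow (k : ℕ) : 2 * ∑ i ∈ Finset.range k, 3 ^ (k - 1 - i) + 1 = 3 ^ k := by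
  rw [Finset.sum_range_reflect (fun i => 3 ^ i) k]
  induction k with
  | zero => simp
  | succ k ih => rw [Finset.sum_range_succ, pow_succ]; omega

theorem sum_ceil_simplex (m : ℕ) :
    2 * ∑ i ∈ Finset.range m, ⌈((3 ^ (m - 1) : ℕ) : ℚ) / 3 ^ i⌉₊ + 1 = 3 ^ m := by
  rw [← two_mul_sum_three_pow m]
  congr 2
  refine Finset.sum_congr rfl fun i hi => ?_
  rw [Finset.mem_range] at hi
  rw [Nat.cast_pow, Nat.cast_ofNat, three_pow_div_three_pow (by omega), Nat.ceil_natCast]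

theorem sum_ceil_two_mul (k : ℕ) :
    2 * ∑ i ∈ Finset.range k, ⌈((3 ^ (2 * k - 1) + 3 ^ (k - 1) : ℕ) : ℚ) / 3 ^ i⌉₊ + 1
      = 3 ^ (2 * k) := by
  have h (i) (hi : i ∈ Finset.range k) :
      ⌈((3 ^ (2 * k - 1) + 3 ^ (k - 1) : ℕ) : ℚ) / 3 ^ i⌉₊
        = 3 ^ k * 3 ^ (k - 1 - i) + 3 ^ (k - 1 - i) := by
    rw [Finset.mem_range] at hi
    rw [Nat.cast_add, Nat.cast_pow, Nat.cast_pow, Nat.cast_ofNat, add_div,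
      three_pow_div_three_pow (by omega), three_pow_div_three_pow (by omega), ← Nat.cast_add,
      Nat.ceil_natCast, ← pow_add]
    congr 3
    omega
  rw [Finset.sum_congr rfl h, Finset.sum_add_distrib, ← Finset.mul_sum]
  have := two_mul_sum_three_pow k
  set S := ∑ i ∈ Finset.range k, 3 ^ (k - 1 - i)
  rw [two_mul k, pow_add, ← this]
  ring

/-! ### The two parities of `m` -/

section

variable {K : Type*} [Field K] [Algebra (ZMod 3) K] {m n : ℕ} {α : K}

theorem evenLikeBchCode_odd [Finite K] {t : ℕ} (ht : t ≠ 0) (hm : m = 2 * t + 1)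
    (hK : Nat.card K = 3 ^ m) (hn : 2 * n + 1 = 3 ^ m) (hα : IsPrimitiveRoot α (2 * n)) :
    HasParameters (evenLikeBchCode (ZMod 3) n (α ^ 2) (largestCosetLeader 3 n)) m (3 ^ (m - 1)) ∧
      nonzeroWeights (evenLikeBchCode (ZMod 3) n (α ^ 2) (largestCosetLeader 3 n)) =
        {3 ^ (m - 1)} := by
  have hδ := two_mul_largestCosetLeader_three (by omega) hn
  obtain ⟨δ, hδ'⟩ : ∃ δ, δ = largestCosetLeader 3 n := ⟨_, rfl⟩
  rw [← hδ'] at hδ ⊢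
  set u := 3 ^ t with hu
  have hu3 : 3 ≤ u := by
    rw [hu]; exact Nat.le_self_pow ht 3
  have e1 : 3 ^ (m - 1) = u * u := by rw [hu, ← pow_add]; congr 1; omega
  have e2 : 3 ^ m = 3 * (u * u) := by rw [← e1, ← pow_succ']; congr 1; omega
  have e3 : (m - 1) / 2 = t := by omega
  rw [e3, ← hu, e1] at hδ
  have hn2 : 2 * n + 1 = 3 * (u * u) := by rw [hn, e2]
  have huu : 3 * u ≤ u * u := Nat.mul_le_mul_right _ hu3
  have hn0 : 0 < n := by omega
  have hnodd : Odd n := by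
    have h9 : (u * u) % 4 = 1 := by
      have : u * u = 9 ^ t := by rw [hu, ← mul_pow]; norm_num
      rw [this, Nat.pow_mod]
      simp
    rw [Nat.odd_iff]
    omega
  have hβ : IsPrimitiveRoot (α ^ 2) n := hα.pow (by omega) rfl
  have hcop : δ.Coprime n := by
    have h2 : ((Nat.gcd δ n : ℕ) : ℤ) ∣ 2 := by
      have d1 : ((Nat.gcd δ n : ℕ) : ℤ) ∣ δ := Int.natCast_dvd_natCast.2 (Nat.gcd_dvd_left _ _)
      have d2 : ((Nat.gcd δ n : ℕ) : ℤ) ∣ n := Int.natCast_dvd_natCast.2 (Nat.gcd_dvd_right _ _)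
      have r1 : (2 * δ + (u * u + u) : ℤ) = 2 * n := by exact_mod_cast hδ
      have r2 : (2 * n + 1 : ℤ) = 3 * (u * u) := by exact_mod_cast hn2
      -- Modulo the gcd, `u² + u = 0` and `3u² = 1`, so `3u = -1`; squaring gives `3 = 9u² = 1`. The
      -- coefficients make this explicit.
      have : (2 : ℤ) = δ * (2 * (3 - 9 * u)) + n * (2 * (6 * u - 5)) := by
        linear_combination (9 * u - 3 : ℤ) * r1 + (3 * u + 2 : ℤ) * r2
      rw [this]
      exact dvd_add (d1.mul_right _) (d2.mul_right _)
    have h2' : Nat.gcd δ n ∣ 2 := by exact_mod_cast h2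
    rcases (Nat.dvd_prime Nat.prime_two).1 h2' with h | h
    · exact h
    · have := h ▸ Nat.gcd_dvd_right δ n
      exact absurd this hnodd.not_two_dvd_nat
  have hγ : IsPrimitiveRoot ((α ^ 2) ^ δ) n := hβ.pow_of_coprime δ hcop
  have hgen (z : K) (hz : z ≠ 0) : ∃ j, z = ((α ^ 2) ^ δ) ^ j ∨ z = -((α ^ 2) ^ δ) ^ j := by
    have : NeZero n := ⟨hn0.ne'⟩
    have : Fintype K := Fintype.ofFinite K
    have h1 : z ^ (2 * n) = 1 := by
      have := FiniteField.pow_card_sub_one_eq_one z hz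
      rwa [← Nat.card_eq_fintype_card, hK, ← hn, Nat.add_sub_cancel] at this
    -- `z^n = ±1`; as `n` is odd, `z` or `-z` is an `n`-th root of unity.
    rw [two_mul, pow_add, mul_self_eq_one_iff] at h1
    rcases h1 with h1 | h1
    · obtain ⟨j, -, hj⟩ := hγ.eq_pow_of_pow_eq_one h1
      exact ⟨j, Or.inl hj.symm⟩
    · obtain ⟨j, -, hj⟩ := hγ.eq_pow_of_pow_eq_one (ξ := -z) (by rw [hnodd.neg_pow, h1, neg_neg])
      exact ⟨j, Or.inr (by rw [hj, neg_neg])⟩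
  refine evenLikeBchCode_hasParameters (F := ZMod 3) hn0 hβ (by simpa using hδ') (by omega)
    (fun z _ => hgen z) ?_ (by omega) ?_
  · have htop : Algebra.adjoin (ZMod 3) {(α ^ 2) ^ δ} = ⊤ := by
      refine Algebra.eq_top_iff.2 fun z => ?_
      by_cases hz : z = 0
      · exact hz ▸ zero_mem _
      · have := Algebra.self_mem_adjoin_singleton (ZMod 3) ((α ^ 2) ^ δ)
        obtain ⟨j, rfl | rfl⟩ := hgen z hz
        · exact pow_mem this j
        · exact neg_mem (pow_mem this j)
    rw [htop, ZMod.card, ← hK]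
    exact Nat.card_congr (Equiv.Set.univ K)
  · rw [ZMod.card, ← hn, Nat.add_sub_cancel, hn, e2, e1,
      show 3 * (u * u) - u * u = 2 * (u * u) by omega]
    ring

theorem evenLikeBchCode_even [Finite K] {k : ℕ} (hk : 2 ≤ k) (hm : m = 2 * k)
    (hn : 2 * n + 1 = 3 ^ m) (hα : IsPrimitiveRoot α (2 * n)) :
    HasParameters (evenLikeBchCode (ZMod 3) n (α ^ 2) (largestCosetLeader 3 n)) k
        (3 ^ (m - 1) + 3 ^ (k - 1)) ∧
      nonzeroWeights (evenLikeBchCode (ZMod 3) n (α ^ 2) (largestCosetLeader 3 n)) =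
        {3 ^ (m - 1) + 3 ^ (k - 1)} := by
  have hδ := two_mul_largestCosetLeader_three (by omega) hn
  obtain ⟨δ, hδ'⟩ : ∃ δ, δ = largestCosetLeader 3 n := ⟨_, rfl⟩
  rw [← hδ'] at hδ ⊢
  obtain ⟨w, hw⟩ : ∃ w, w = 3 ^ (k - 1) := ⟨_, rfl⟩
  have hw3 : 3 ≤ w := by rw [hw]; exact Nat.le_self_pow (by omega) 3
  have e0 : 3 ^ k = 3 * w := by rw [hw, ← pow_succ']; congr 1; omega
  have e1 : 3 ^ (m - 1) = 3 * w * w := by rw [← e0, hw, ← pow_add]; congr 1; omega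
  have e2 : 3 ^ m = 9 * (w * w) := by
    rw [hm, two_mul, pow_add, e0]; ring
  rw [show (m - 1) / 2 = k - 1 by omega, e1, ← hw] at hδ
  have hn2 : 2 * n + 1 = 9 * (w * w) := by rw [hn, e2]
  have hww : 3 * w ≤ w * w := Nat.mul_le_mul_right _ hw3
  have hn0 : 0 < n := by omega
  -- This avoids subtraction in `2n = (3w+1)(3w-1)` and `2δ = (3w+1)(2w-1)`. As `2w-1` and `3w-1`
  -- are coprime, `α^(2δ)` has order `3w-1 = 3^k - 1`.
  obtain ⟨x, rfl⟩ : ∃ x, w = x + 1 := ⟨w - 1, by omega⟩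
  have hβ : IsPrimitiveRoot (α ^ 2) n := hα.pow (by omega) rfl
  have h2n : 2 * n = (3 * x + 4) * (3 * x + 2) := by linarith
  have h2δ : 2 * δ = (3 * x + 4) * (2 * x + 1) := by linarith
  have hcop : (2 * x + 1).Coprime (3 * x + 2) := by
    rw [← Nat.isCoprime_iff_coprime]
    exact ⟨-3, 2, by push_cast; ring⟩
  have hγ : IsPrimitiveRoot ((α ^ 2) ^ δ) (Fintype.card (ZMod 3) ^ k - 1) := by
    rw [ZMod.card, e0, ← pow_mul, h2δ, pow_mul]
    exact (hα.pow (by omega) h2n).pow_of_coprime _ hcop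
  refine evenLikeBchCode_hasParameters (F := ZMod 3) hn0 hβ (by simpa using hδ')
    (by rintro rfl; simp at h2δ) (fun z hz hz0 => ?_) (card_adjoin_eq (by omega) hγ) (by omega) ?_
  · obtain ⟨j, -, rfl⟩ := exists_pow_eq_of_mem_adjoin (by omega) hγ hz hz0
    exact ⟨j, Or.inl rfl⟩
  · rw [ZMod.card, e0, e1, ← hw, show 3 * (x + 1) - 1 = 3 * x + 2 by omega,
      show 3 * (x + 1) - (x + 1) = 2 * (x + 1) by omega]
    linear_combination (x + 1) * h2n.symm

end

theorem mainTheorem4 (m : ℕ) (hm : 3 ≤ m)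
    (K : Type*) [Field K] [Algebra (ZMod 3) K] (hK : Nat.card K = 3 ^ m)
    (α : Kˣ) (hα : ∀ x : Kˣ, x ∈ Subgroup.zpowers α)
    (n : ℕ) (hn : n = (3 ^ m - 1) / 2)
    (β : K) (hβ : β = (α : K) ^ ((3 ^ m - 1) / n))
    (C : Submodule (ZMod 3) (Fin n → ZMod 3))
    (hC : C = evenLikeBchCode (ZMod 3) n β (largestCosetLeader 3 n)) :
    (Odd m → HasParameters C m (3 ^ (m - 1)) ∧ nonzeroWeights C = {3 ^ (m - 1)}) ∧
    (Even m → HasParameters C (m / 2) (3 ^ (m - 1) + 3 ^ (m / 2 - 1)) ∧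
      nonzeroWeights C = {3 ^ (m - 1) + 3 ^ (m / 2 - 1)}) ∧
    MeetsGriesmerBound C := by
  have hfin : Finite K := Nat.finite_of_card_ne_zero (by rw [hK]; positivity)
  have hodd : Odd (3 ^ m) := Odd.pow (by decide)
  have hn' : 2 * n + 1 = 3 ^ m := by
    rw [Nat.odd_iff] at hodd
    omega
  have hm1 : 1 < 3 ^ m := Nat.one_lt_pow (by omega) (by norm_num)
  have hn0 : 0 < n := by omega
  have hdiv : (3 ^ m - 1) / n = 2 := by
    rw [← hn', Nat.add_sub_cancel, Nat.mul_div_cancel _ hn0]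
  have hprim : IsPrimitiveRoot (α : K) (2 * n) := by
    rw [IsPrimitiveRoot.coe_units_iff]
    have := orderOf_eq_card_of_forall_mem_zpowers hα
    rw [Nat.card_units, hK, ← hn', Nat.add_sub_cancel] at this
    exact this ▸ IsPrimitiveRoot.orderOf α
  rw [hdiv] at hβ
  subst hβ hC
  have hO (h : Odd m) := evenLikeBchCode_odd (t := m / 2) (by omega)
    (Nat.two_mul_div_two_add_one_of_odd h).symm hK hn' hprim
  have hE (h : Even m) := evenLikeBchCode_even (k := m / 2)
    (by rw [Nat.even_iff] at h; omega)
    (Nat.two_mul_div_two_of_even h).symm hn' hprim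
  refine ⟨hO, hE, ?_⟩
  rcases Nat.even_or_odd m with h | h
  · refine ⟨_, _, (hE h).1, ?_⟩
    have := sum_ceil_two_mul (m / 2)
    rw [Nat.two_mul_div_two_of_even h] at this
    rw [ZMod.card, Nat.cast_ofNat]
    omega
  · refine ⟨_, _, (hO h).1, ?_⟩
    have := sum_ceil_simplex m
    rw [ZMod.card, Nat.cast_ofNat]
    omega
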